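/- For integers $n\ge 1$ and $\nu\ge 0$, let $\alpha^{n,\nu}:\mathbb Z\to\mathbb R$ be the pseudo-spline mask, i.e. the finitely supported sequence with symbol $$\alpha^{n,\nu}(z)=\sum_{l\in\mathbb Z}\alpha^{n,\nu}_l z^l=\frac{z^{-\lfloor n/2\rfloor}(1+z)^n}{2^{n-1}}\sum_{j=0}^{\nu}\binom{n/2+j-1}{j}\Bigl(\frac12-\frac{z+z^{-1}}4\Bigr)^j .$$ For a sequence $\alpha$ let $(\alpha_{ev})_l=\alpha_{2l}$, let $(S_\alpha c)_m=\sum_{l}\alpha_{m-2l}c_l$ be the subdivision operator, and for $\gamma\in l_1(\mathbb Z)$ let $D_\gamma:l_\infty(\mathbb Z)\to l_\infty(\mathbb Z)$, $(D_\gamma c)_m=\sum_{l}\gamma_l\,c_{2(m-l)}$, be the decimation operator, with operator norm $\|D_\gamma\|_\infty$. Theorem. Let $k\ge 2$ and $0\le\nu\le k-1$. Then $\alpha^{2k,\nu}_{ev}(z)\ne 0$ for all $|z|=1$, there is exactly one real sequence $\gamma\in l_1(\mathbb Z)$ with $\gamma(z)=1/\alpha^{2k,\nu}_{ev}(z)$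 for all $|z|=1$, and $D_\gamma$ is an even-inverse of $S_{\alpha^{2k,\nu}}$, that is, $(S_{\alpha^{2k,\nu}}D_\gamma c)_{2m}=c_{2m}$ for all $c\in l_\infty(\mathbb Z)$ and $m\in\mathbb Z$. Moreover $$\|D_\gamma\|_\infty=\|\gamma\|_1\le C(k,\nu):=\kappa\cdot\max\Bigl\{1,\frac{(1+\sqrt\kappa)^2}{2\kappa}\Bigr\}\cdot\frac{1+\lambda}{1-\lambda},$$ where $$\kappa=\frac{2^{k+\nu-1}}{\sum_{j=0}^{\nu}\binom{k+\nu}{j}},\qquad \lambda=\Bigl(\frac{\sqrt\kappa-1}{\sqrt\kappa+1}\Bigr)^{1/s},\qquad s=\Bigl\lfloor\frac{k+\nu}2\Bigr\rfloor .$$ -/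

import Mathlib

open scoped ENNReal

noncomputable section

namespace PseudoSpline

/-- Real sequences of `l_1(ℤ)` (the masks), with the norm `‖a‖ = ∑ |a k|`. -/
abbrev SeqL1 : Type := lp (fun _ : ℤ => ℝ) 1

/-- Bounded real sequences `l_∞(ℤ)`, with the supremum norm. -/
abbrev SeqLInf : Type := lp (fun _ : ℤ => ℝ) ∞

/-- The symbol `c(z) = ∑ c_k z^k` of a real sequence. -/
def symbol (c : ℤ → ℝ) (z : ℂ) : ℂ := ∑' k : ℤ, (c k : ℂ) * z ^ k

/-- The even part of a sequence, which is also its downsampling. -/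
def evenPart (c : ℤ → ℝ) : ℤ → ℝ := fun k => c (2 * k)

/-- The `l_1` sequence `γ` is the inverse of the sequence `a`: `γ(z) = 1 / a(z)`, where `a(z) ≠ 0`,
for all `z` on the unit circle. -/
def IsMaskInverse (a : ℤ → ℝ) (γ : SeqL1) : Prop :=
  ∀ z : ℂ, ‖z‖ = 1 → symbol a z ≠ 0 ∧ symbol γ z = 1 / symbol a z

/-- The subdivision operator `(S_α c)_k = ∑ α_{k - 2l} c_l`. -/
def subdivision (α c : ℤ → ℝ) : ℤ → ℝ := fun k => ∑' l : ℤ, α (k - 2 * l) * c l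

/-- The convolution `(a * c)_k = ∑ a_l c_{k - l}`. -/
def convolution (a c : ℤ → ℝ) : ℤ → ℝ := fun k => ∑' l : ℤ, a l * c (k - l)

theorem summable_norm (a : SeqL1) : Summable fun l : ℤ => ‖a l‖ := by
  simpa using (lp.memℓp a).summable (by simp)

theorem norm_term_le (a : SeqL1) (c : SeqLInf) (l m : ℤ) : ‖a l * c m‖ ≤ ‖a l‖ * ‖c‖ := by
  rw [norm_mul]
  exact mul_le_mul_of_nonneg_left (lp.norm_apply_le_norm (by simp) c m) (norm_nonneg _)

theorem summable_term (a : SeqL1) (c : SeqLInf) (f : ℤ → ℤ) :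
    Summable fun l : ℤ => a l * c (f l) :=
  Summable.of_norm_bounded ((summable_norm a).mul_right ‖c‖) fun l => norm_term_le a c l (f l)

theorem norm_eq_tsum (a : SeqL1) : ‖a‖ = ∑' l : ℤ, ‖a l‖ := by
  simpa using lp.norm_eq_tsum_rpow (p := 1) (by simp) a

theorem norm_tsum_term_le (a : SeqL1) (c : SeqLInf) (f : ℤ → ℤ) :
    ‖∑' l : ℤ, a l * c (f l)‖ ≤ ‖a‖ * ‖c‖ := by
  rw [norm_eq_tsum, ← tsum_mul_right]
  exact tsum_of_norm_bounded ((summable_norm a).mul_right ‖c‖).hasSum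
    fun l => norm_term_le a c l (f l)

/-- The decimation operator `D_γ c = γ * (c ↓ 2)` as a bounded operator on `l_∞(ℤ)`; its norm is
the operator norm `‖D_γ‖_∞`. -/
def decimation (γ : SeqL1) : SeqLInf →L[ℝ] SeqLInf :=
  LinearMap.mkContinuous
    { toFun := fun c =>
        ⟨convolution γ (evenPart c), memℓp_infty ⟨‖γ‖ * ‖c‖, by
          rintro _ ⟨k, rfl⟩
          exact norm_tsum_term_le γ c fun l => 2 * (k - l)⟩⟩
      map_add' := fun c d => by
        ext k
        change ∑' l : ℤ, γ l * (c (2 * (k - l)) + d (2 * (k - l))) =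
          (∑' l : ℤ, γ l * c (2 * (k - l))) + ∑' l : ℤ, γ l * d (2 * (k - l))
        rw [← (summable_term γ c _).tsum_add (summable_term γ d _)]
        simp only [mul_add]
      map_smul' := fun r c => by
        ext k
        change ∑' l : ℤ, γ l * (r * c (2 * (k - l))) = r * ∑' l : ℤ, γ l * c (2 * (k - l))
        rw [← tsum_mul_left]
        exact tsum_congr fun l => by ring }
    ‖γ‖ fun c => lp.norm_le_of_forall_le (by positivity) fun k =>
      norm_tsum_term_le γ c fun l => 2 * (k - l)

/-- `D_γ` is an even-inverse of `S_α`: `[(Id - S_α D_γ) c] ↓ 2 = 0` for every bounded `c`. -/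
def IsEvenInverse (α : ℤ → ℝ) (γ : SeqL1) : Prop :=
  ∀ (c : SeqLInf) (k : ℤ), c (2 * k) - subdivision α (decimation γ c) (2 * k) = 0

open LaurentPolynomial in
/-- The symbol of the pseudo-spline mask with parameters `n ≥ 1` and `ν`, as a Laurent polynomial in
`z = T 1`; the binomial coefficients have the real upper argument `n / 2 + j - 1`. -/
def pseudoSplineSymbol (n ν : ℕ) : LaurentPolynomial ℝ :=
  C (1 / 2 ^ (n - 1)) * T (-((n / 2 : ℕ) : ℤ)) * (1 + T 1) ^ n *
    ∑ j ∈ Finset.range (ν + 1),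
      C (Ring.choose ((n : ℝ) / 2 + j - 1) j) * (C (1 / 2) - C (1 / 4) * (T 1 + T (-1))) ^ j

/-- The pseudo-spline mask: the coefficient sequence of its symbol. -/
def pseudoSplineMask (n ν : ℕ) : ℤ → ℝ := fun l => (pseudoSplineSymbol n ν).coeff l

/-- `κ = 2 ^ (k + ν - 1) / ∑_{j ≤ ν} (k + ν choose j)`. -/
def kappa (k ν : ℕ) : ℝ :=
  2 ^ (k + ν - 1) / ∑ j ∈ Finset.range (ν + 1), ((k + ν).choose j : ℝ)

/-- `λ = ((√κ - 1) / (√κ + 1)) ^ (1 / s)` with `s = ⌊(k + ν) / 2⌋`. -/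
def decayRate (k ν : ℕ) : ℝ :=
  ((√(kappa k ν) - 1) / (√(kappa k ν) + 1)) ^ (1 / (((k + ν) / 2 : ℕ) : ℝ))

/-- The constant `C(k, ν)`. -/
def boundConst (k ν : ℕ) : ℝ :=
  kappa k ν * max 1 ((1 + √(kappa k ν)) ^ 2 / (2 * kappa k ν)) *
    ((1 + decayRate k ν) / (1 - decayRate k ν))

end PseudoSpline

end

/-! Write `k + 1` for the `k` of the theorem, so that the hypothesis becomes `ν ≤ k`. On the unit
circle the mask symbol is `2 B(y)`, where `y = (1 - Re z) / 2` and `B` is `negBinomialCDF k ν`.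
Averaging over `z` and `-z`, the even symbol at `z ^ 2` is `B(y) + B(1 - y)`. The derivative of `B`
is a single monomial in `y` and `1 - y`, so this sum decreases on `[0, 1/2]`; by symmetry its values
lie between `2 B(1/2) = 1/κ` and `1` (`negBinomialCDF_add_mem_Icc`).

The even symbol is thus a trigonometric polynomial of degree at most `s` with values in `[1/κ, 1]`.
As for inverses of banded matrices, polynomial approximation of `1/x` on this interval makes the
Fourier coefficients of the reciprocal decay geometrically. Explicit Chebyshev approximants give
error of order `q ^ (n + 1)`, with `q = (√κ - 1) / (√κ + 1)`, by trigonometric polynomials of degree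
at most `n * s` (`norm_fourierCoeff_inv_le`). Hence `|γ_l| ≤ const * λ ^ |l|` with `λ ^ s = q`, and
summing over `l` yields the constant.

This summability also produces `γ`; injectivity of the symbol gives uniqueness and turns `γ(z) a(z)
= 1` into a convolution identity, hence the even-inverse property. A sign sequence shows that the
decimation norm equals `‖γ‖`. -/

noncomputable section

namespace PseudoSpline

/-! ### Range of the even symbol: a negative binomial polynomial -/

/-- The polynomial `(1 - y) ^ (k + 1) * ∑_{j ≤ ν} (k + j choose j) y ^ j`: the probability that at
most `ν` failures, of probability `y` each, precede the `k + 1`-st success. -/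
def negBinomialCDF (k ν : ℕ) (y : ℝ) : ℝ :=
  (1 - y) ^ (k + 1) * ∑ j ∈ Finset.range (ν + 1), ((k + j).choose j : ℝ) * y ^ j

theorem negBinomialCDF_succ (k ν : ℕ) (y : ℝ) :
    negBinomialCDF k (ν + 1) y = negBinomialCDF k ν y +
      (1 - y) ^ (k + 1) * (((k + ν + 1).choose (ν + 1) : ℝ) * y ^ (ν + 1)) := by
  rw [negBinomialCDF, Finset.sum_range_succ, mul_add, ← negBinomialCDF, add_assoc k ν 1]

/-- Adding a term to the sum cancels the previous derivative, by `(N choose (ν + 1)) (ν + 1) = (N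
choose ν) (k + 1)` with `N = k + 1 + ν`; one monomial survives. -/
theorem hasDerivAt_negBinomialCDF (k ν : ℕ) (y : ℝ) :
    HasDerivAt (negBinomialCDF k ν)
      (-((k + 1) * ((k + 1 + ν).choose ν : ℝ) * (y ^ ν * (1 - y) ^ k))) y := by
  have h1 : HasDerivAt (fun y : ℝ => (1 - y) ^ (k + 1)) (-((k + 1) * (1 - y) ^ k)) y := by
    simpa using ((hasDerivAt_id y).const_sub 1).fun_pow (k + 1)
  induction ν with
  | zero =>
    have : negBinomialCDF k 0 = fun y : ℝ => (1 - y) ^ (k + 1) := by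
      funext y; simp [negBinomialCDF]
    rw [this]
    simpa using h1
  | succ ν ih =>
    have h2 : HasDerivAt (fun y : ℝ => y ^ (ν + 1)) ((ν + 1) * y ^ ν) y := by
      simpa using hasDerivAt_pow (ν + 1) y
    have h3 := ih.add (h1.mul (h2.const_mul ((k + ν + 1).choose (ν + 1) : ℝ)))
    have h4 : negBinomialCDF k (ν + 1) = negBinomialCDF k ν + (fun y : ℝ => (1 - y) ^ (k + 1)) *
        fun y : ℝ => ((k + ν + 1).choose (ν + 1) : ℝ) * y ^ (ν + 1) := by
      funext y; exact negBinomialCDF_succ k ν y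
    rw [h4]
    refine h3.congr_deriv ?_
    have e1 : ((k + 1 + ν).choose (ν + 1) : ℝ) * (ν + 1) = (k + 1 + ν).choose ν * (k + 1) := by
      have := Nat.choose_succ_right_eq (k + 1 + ν) ν
      rw [Nat.add_sub_cancel] at this
      exact_mod_cast this
    have e2 : ((k + 1 + (ν + 1)).choose (ν + 1) : ℝ) =
        (k + 1 + ν).choose ν + (k + 1 + ν).choose (ν + 1) := by
      exact_mod_cast Nat.choose_succ_succ (k + 1 + ν) ν
    rw [e2, show k + ν + 1 = k + 1 + ν by ring]
    linear_combination (1 - y) ^ (k + 1) * y ^ ν * e1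

theorem negBinomialCDF_zero (k ν : ℕ) : negBinomialCDF k ν 0 = 1 := by
  simp [negBinomialCDF, Finset.sum_range_succ']

theorem negBinomialCDF_one (k ν : ℕ) : negBinomialCDF k ν 1 = 0 := by
  simp [negBinomialCDF]

/-- The derivative is a nonnegative multiple of `(y (1 - y)) ^ ν * (y ^ (k - ν) - (1 - y) ^ (k -
ν))`, which is nonpositive for `y ≤ 1/2`. -/
theorem antitoneOn_negBinomialCDF_add {k ν : ℕ} (h : ν ≤ k) :
    AntitoneOn (fun y => negBinomialCDF k ν y + negBinomialCDF k ν (1 - y))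
      (Set.Icc 0 (1 / 2)) := by
  have hd (y : ℝ) := (hasDerivAt_negBinomialCDF k ν y).add
    ((hasDerivAt_negBinomialCDF k ν (1 - y)).comp y ((hasDerivAt_id y).const_sub 1))
  refine antitoneOn_of_deriv_nonpos (convex_Icc _ _)
    (fun y _ => (hd y).continuousAt.continuousWithinAt)
    (fun y _ => (hd y).differentiableAt.differentiableWithinAt) fun y hy => ?_
  rw [interior_Icc] at hy
  obtain ⟨d, rfl⟩ := Nat.exists_eq_add_of_le h
  have hp : y ^ d ≤ (1 - y) ^ d := pow_le_pow_left₀ hy.1.le (by linarith [hy.2]) d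
  have h1 : 0 ≤ y := hy.1.le
  have h2 : 0 ≤ 1 - y := by linarith [hy.2]
  have h3 : 0 ≤ (((ν + d : ℕ) : ℝ) + 1) * ((ν + d + 1 + ν).choose ν : ℝ) * (y ^ ν * (1 - y) ^ ν) *
      ((1 - y) ^ d - y ^ d) :=
    mul_nonneg (by positivity) (by linarith)
  refine ((hd y).deriv.trans ?_).trans_le (neg_nonpos.2 h3)
  ring

theorem negBinomialCDF_add_mem_Icc {k ν : ℕ} (h : ν ≤ k) {y : ℝ} (h0 : 0 ≤ y) (h1 : y ≤ 1) :
    negBinomialCDF k ν y + negBinomialCDF k ν (1 - y) ∈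
      Set.Icc (2 * negBinomialCDF k ν (1 / 2)) 1 := by
  wlog hy : y ≤ 1 / 2 generalizing y
  · simpa [add_comm] using this (y := 1 - y) (by linarith) (by linarith) (by linarith)
  have ha := antitoneOn_negBinomialCDF_add h
  constructor
  · convert ha ⟨h0, hy⟩ ⟨by norm_num, le_rfl⟩ hy using 1
    norm_num [two_mul]
  · convert ha ⟨le_rfl, by norm_num⟩ ⟨h0, hy⟩ h0 using 1
    simp [negBinomialCDF_zero, negBinomialCDF_one]

/-- At most `ν` failures precede success number `k + 1` exactly when `k + 1 + ν` fair tosses contain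
at most `ν` failures. Algebraically, both sides satisfy the same recursion in `ν`, by Pascal's rule.
-/
theorem two_pow_mul_negBinomialCDF_half (k ν : ℕ) :
    2 ^ (k + 1 + ν) * negBinomialCDF k ν (1 / 2) =
      ∑ j ∈ Finset.range (ν + 1), ((k + 1 + ν).choose j : ℝ) := by
  induction ν with
  | zero => simp [negBinomialCDF]; norm_num [← mul_pow]
  | succ ν ih =>
    have h : ∑ j ∈ Finset.range (ν + 2), ((k + 1 + (ν + 1)).choose j : ℝ) =
        2 * ∑ j ∈ Finset.range (ν + 1), ((k + 1 + ν).choose j : ℝ) +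
          (k + 1 + ν).choose (ν + 1) := by
      rw [Finset.sum_range_succ']
      have (j : ℕ) : ((k + 1 + (ν + 1)).choose (j + 1) : ℝ) =
          (k + 1 + ν).choose j + (k + 1 + ν).choose (j + 1) := by
        exact_mod_cast Nat.choose_succ_succ (k + 1 + ν) j
      simp only [this, Finset.sum_add_distrib]
      have h2 := Finset.sum_range_succ' (fun j => ((k + 1 + ν).choose j : ℝ)) (ν + 1)
      rw [Finset.sum_range_succ] at h2
      simp only [Nat.choose_zero_right] at h2 ⊢
      linarith
    rw [h, ← ih, negBinomialCDF_succ, show k + ν + 1 = k + 1 + ν by ring]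
    have e : (2 : ℝ) ^ (k + 1 + (ν + 1)) * ((1 / 2) ^ (k + 1) * (1 / 2) ^ (ν + 1)) = 1 := by
      rw [← pow_add, ← mul_pow]; norm_num
    rw [show (1 : ℝ) - 1 / 2 = 1 / 2 by norm_num]
    linear_combination ((k + 1 + ν).choose (ν + 1) : ℝ) * e

theorem kappa_pos (k ν : ℕ) : 0 < kappa k ν := by
  refine div_pos (by positivity) ?_
  rw [Finset.sum_range_succ']
  simp only [Nat.choose_zero_right, Nat.cast_one]
  positivity

theorem two_mul_negBinomialCDF_half (k ν : ℕ) :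
    2 * negBinomialCDF k ν (1 / 2) = (kappa (k + 1) ν)⁻¹ := by
  rw [kappa, inv_div, ← two_pow_mul_negBinomialCDF_half, eq_div_iff (by positivity),
    show k + 1 + ν = (k + 1 + ν - 1) + 1 by omega, pow_succ, Nat.add_sub_cancel]
  ring

theorem one_le_kappa {k ν : ℕ} (h : ν ≤ k) : 1 ≤ kappa (k + 1) ν := by
  have := negBinomialCDF_add_mem_Icc h le_rfl zero_le_one
  rw [two_mul_negBinomialCDF_half] at this
  exact (inv_le_one₀ (kappa_pos _ _)).1 (this.1.trans this.2)

/-! ### Chebyshev approximation of a reciprocal -/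

open Polynomial in
/-- The best uniform approximation of degree `n` to `1 / (1 + q ^ 2 - 2 q x)` on `[-1, 1]`. -/
def chebyshevApprox (q : ℝ) : ℕ → ℝ[X]
  | 0 => C ((1 + q ^ 2) / (1 - q ^ 2) ^ 2)
  | n + 1 => chebyshevApprox q n +
      C (2 * q ^ (n + 1) / (1 - q ^ 2) ^ 2) *
        (Chebyshev.T ℝ ((n : ℤ) + 1) - C q * Chebyshev.T ℝ (n : ℤ))

open Polynomial in
theorem natDegree_chebyshevApprox_le (q : ℝ) (n : ℕ) : (chebyshevApprox q n).natDegree ≤ n := by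
  induction n with
  | zero => simp [chebyshevApprox]
  | succ n ih =>
    rw [chebyshevApprox]
    refine natDegree_add_le_of_degree_le (ih.trans n.le_succ) ?_
    refine (natDegree_C_mul_le _ _).trans 
      ((natDegree_sub_le_of_le (m := n + 1) (n := n + 1) ?_ ?_).trans (max_self _).le)
    · rw [Chebyshev.natDegree_T]; omega
    · refine (natDegree_C_mul_le _ _).trans ?_
      rw [Chebyshev.natDegree_T]; omega

open Polynomial in
-- The Chebyshev recurrence carries the residual from `n` to `n + 1`, so it remains one combination
-- of three consecutive polynomials. The case `n = 0` uses `T (-1) = T 1`.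
theorem mul_eval_chebyshevApprox {q : ℝ} (hq : 1 - q ^ 2 ≠ 0) (x : ℝ) (n : ℕ) :
    (1 + q ^ 2 - 2 * q * x) * (chebyshevApprox q n).eval x =
      1 - 2 * q ^ (n + 1) / (1 - q ^ 2) ^ 2 *
        ((Chebyshev.T ℝ ((n : ℤ) + 1)).eval x - 2 * q * (Chebyshev.T ℝ (n : ℤ)).eval x +
          q ^ 2 * (Chebyshev.T ℝ ((n : ℤ) - 1)).eval x) := by
  induction n with
  | zero =>
    simp [chebyshevApprox]
    field_simp
    ring
  | succ n ih =>
    have h1 := congrArg (eval x) (Chebyshev.T_add_two ℝ (n : ℤ))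
    have h2 := congrArg (eval x) (Chebyshev.T_add_two ℝ ((n : ℤ) - 1))
    rw [show (n : ℤ) - 1 + 2 = n + 1 by ring, show (n : ℤ) - 1 + 1 = n by ring] at h2
    simp only [eval_sub, eval_mul, eval_X, eval_ofNat] at h1 h2
    rw [chebyshevApprox, eval_add, mul_add, ih]
    push_cast
    rw [show (n : ℤ) + 1 + 1 = n + 2 by ring, show (n : ℤ) + 1 - 1 = n by ring, h1]
    simp only [eval_sub, eval_mul, eval_C]
    linear_combination -(2 * q ^ (n + 1) / (1 - q ^ 2) ^ 2) * q ^ 2 * h2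

open Polynomial in
-- For `x = cos θ` the combination is the real part of `e^{i(n-1)θ} (e^{iθ} - q) ^ 2`, whose modulus
-- is `|e^{iθ} - q| ^ 2 = 1 + q ^ 2 - 2 q x`.
theorem abs_chebyshev_combination_le (q : ℝ) {x : ℝ} (hx : |x| ≤ 1) (n : ℤ) :
    |(Chebyshev.T ℝ (n + 1)).eval x - 2 * q * (Chebyshev.T ℝ n).eval x +
      q ^ 2 * (Chebyshev.T ℝ (n - 1)).eval x| ≤ 1 + q ^ 2 - 2 * q * x := by
  obtain ⟨θ, rfl⟩ : ∃ θ, Real.cos θ = x := ⟨_, Real.cos_arccos (abs_le.1 hx).1 (abs_le.1 hx).2⟩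
  simp only [Chebyshev.T_real_cos]
  push_cast
  rw [add_one_mul, sub_one_mul, Real.cos_add, Real.cos_sub]
  set a := Real.cos (n * θ)
  set b := Real.sin (n * θ)
  have h1 : a ^ 2 + b ^ 2 = 1 := Real.cos_sq_add_sin_sq _
  have h2 := Real.cos_sq_add_sin_sq θ
  set c := Real.cos θ
  set s := Real.sin θ
  have h3 : 0 ≤ 1 + q ^ 2 - 2 * q * c := by nlinarith [sq_nonneg (1 - q * c), sq_nonneg (q * s)]
  refine abs_le_of_sq_le_sq ?_ h3
  have h4 : (1 + q ^ 2 - 2 * q * c) ^ 2 =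
      ((1 + q ^ 2) * c - 2 * q) ^ 2 + ((1 - q ^ 2) * s) ^ 2 := by
    linear_combination (-(1 - q ^ 2) ^ 2) * h2
  -- The first hint is the square of the imaginary part of that complex number.
  nlinarith [sq_nonneg (b * ((1 + q ^ 2) * c - 2 * q) + a * ((1 - q ^ 2) * s)),
    mul_comm a b]

theorem abs_inv_sub_eval_chebyshevApprox_le {q : ℝ} (h0 : 0 ≤ q) (h1 : q < 1) {x : ℝ}
    (hx : |x| ≤ 1) (n : ℕ) :
    |(1 + q ^ 2 - 2 * q * x)⁻¹ - (chebyshevApprox q n).eval x| ≤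
      2 * q ^ (n + 1) / (1 - q ^ 2) ^ 2 := by
  have hq : 1 - q ^ 2 ≠ 0 := by nlinarith
  have hd : 0 < 1 + q ^ 2 - 2 * q * x := by
    nlinarith [(abs_le.1 hx).2, mul_pos (sub_pos.2 h1) (sub_pos.2 h1)]
  have h2 := abs_chebyshev_combination_le q hx n
  have h3 := mul_eval_chebyshevApprox hq x n
  rw [← mul_le_mul_iff_right₀ hd]
  nth_rw 1 [← abs_of_pos hd]
  rw [← abs_mul, mul_sub, mul_inv_cancel₀ hd.ne', h3, sub_sub_cancel, abs_mul,
    abs_of_nonneg (by positivity), mul_comm (1 + q ^ 2 - 2 * q * x)]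
  gcongr

/-! ### Degree bounds for trigonometric and Laurent polynomials -/

section Band

variable {R A : Type*} [CommSemiring R] [CommSemiring A] [Algebra R A]

variable (R) in
/-- The span of `e l` for `|l| ≤ d`: for a family of characters `e`, the trigonometric polynomials
of degree at most `d`. -/
def band (e : ℤ → A) (d : ℕ) : Submodule R A :=
  Submodule.span R (e '' {l | |l| ≤ d})

variable {e : ℤ → A}

theorem mem_band {l : ℤ} {d : ℕ} (h : |l| ≤ d) : e l ∈ band R e d :=
  Submodule.subset_span ⟨l, h, rfl⟩

theorem band_mono {c d : ℕ} (h : c ≤ d) : band R e c ≤ band R e d :=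
  Submodule.span_mono (Set.image_mono fun l (hl : |l| ≤ c) => hl.trans (by exact_mod_cast h))

theorem one_mem_band (h0 : e 0 = 1) (d : ℕ) : (1 : A) ∈ band R e d :=
  h0 ▸ mem_band (by simp)

theorem algebraMap_mem_band (h0 : e 0 = 1) (r : R) (d : ℕ) : algebraMap R A r ∈ band R e d := by
  rw [Algebra.algebraMap_eq_smul_one]
  exact Submodule.smul_mem _ _ (one_mem_band h0 d)

theorem mul_mem_band (he : ∀ l m, e (l + m) = e l * e m) {c d : ℕ} {x y : A}
    (hx : x ∈ band R e c) (hy : y ∈ band R e d) : x * y ∈ band R e (c + d) := by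
  have h := Submodule.mul_mem_mul hx hy
  rw [band, band, Submodule.span_mul_span] at h
  refine Submodule.span_le.2 ?_ h
  rintro _ ⟨_, ⟨l, hl, rfl⟩, _, ⟨m, hm, rfl⟩, rfl⟩
  simp only [Set.mem_ofPred_eq] at hl hm
  change e l * e m ∈ _
  rw [← he]
  exact mem_band ((abs_add_le l m).trans (by push_cast; exact add_le_add hl hm))

theorem pow_mem_band (h0 : e 0 = 1) (he : ∀ l m, e (l + m) = e l * e m) {d : ℕ} {x : A}
    (hx : x ∈ band R e d) (n : ℕ) : x ^ n ∈ band R e (n * d) := by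
  induction n with
  | zero => simpa using one_mem_band h0 _
  | succ n ih =>
    rw [pow_succ, add_one_mul]
    exact mul_mem_band he ih hx

theorem aeval_mem_band (h0 : e 0 = 1) (he : ∀ l m, e (l + m) = e l * e m) {d : ℕ} {x : A}
    (hx : x ∈ band R e d) {p : Polynomial R} {n : ℕ} (hp : p.natDegree ≤ n) :
    Polynomial.aeval x p ∈ band R e (n * d) := by
  rw [Polynomial.aeval_eq_sum_range]
  refine Submodule.sum_mem _ fun i hi => Submodule.smul_mem _ _ ?_
  have : i ≤ n := (Nat.lt_succ_iff.1 (Finset.mem_range.1 hi)).trans hp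
  exact band_mono (Nat.mul_le_mul_right d this) (pow_mem_band h0 he hx i)

end Band

/-! ### Fourier decay of the reciprocal of a trigonometric polynomial -/

section Fourier

/-- The `n`-th Fourier coefficient as a continuous linear functional. -/
def fourierCoeffCLM (n : ℤ) : C(UnitAddCircle, ℂ) →L[ℂ] ℂ :=
  LinearMap.mkContinuous
    { toFun := fun F => fourierCoeff F n
      map_add' := fun F G => by
        have h (F : C(UnitAddCircle, ℂ)) :
            MeasureTheory.Integrable F (AddCircle.haarAddCircle (T := 1)) :=
          F.continuous.integrable_of_hasCompactSupport (HasCompactSupport.of_compactSpace F)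
        rw [ContinuousMap.coe_add, fourierCoeff.add (h F) (h G), Pi.add_apply]
      map_smul' := fun c F => by
        rw [ContinuousMap.coe_smul, fourierCoeff.const_smul, RingHom.id_apply] }
    1 fun F => by
      refine (MeasureTheory.norm_integral_le_of_norm_le_const (C := 1 * ‖F‖)
        (Filter.Eventually.of_forall fun t => ?_)).trans (by simp)
      rw [norm_smul]
      exact mul_le_mul (((fourier (T := 1) (-n)).norm_coe_le_norm t).trans (fourier_norm _).le)
        (F.norm_coe_le_norm t) (norm_nonneg _) zero_le_one

@[simp]
theorem fourierCoeffCLM_apply (n : ℤ) (F : C(UnitAddCircle, ℂ)) :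
    fourierCoeffCLM n F = fourierCoeff F n := rfl

theorem norm_fourierCoeff_le {F : C(UnitAddCircle, ℂ)} {M : ℝ} (h : ∀ t, ‖F t‖ ≤ M) (n : ℤ) :
    ‖fourierCoeff F n‖ ≤ M := by
  have h1 : ‖fourierCoeffCLM n F‖ ≤ 1 * ‖F‖ :=
    (fourierCoeffCLM n).le_of_opNorm_le (LinearMap.mkContinuous_norm_le _ zero_le_one _) F
  rw [one_mul] at h1
  exact h1.trans ((ContinuousMap.norm_le _ ((norm_nonneg _).trans (h 0))).2 h)

theorem fourierCoeff_eq_zero_of_mem_band {F : C(UnitAddCircle, ℂ)} {d : ℕ}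
    (hF : F ∈ band ℂ (fourier (T := 1)) d) {l : ℤ} (hl : d < |l|) : fourierCoeff F l = 0 := by
  have : band ℂ (fourier (T := 1)) d ≤ LinearMap.ker (fourierCoeffCLM l).toLinearMap := by
    refine Submodule.span_le.2 ?_
    rintro _ ⟨m, hm, rfl⟩
    have hne : l ≠ m := by rintro rfl; exact absurd hm (not_le.2 hl)
    simp [fourierCoeff_fourier, hne, -fourier_apply]
  exact this hF

theorem fourier_map_zero : (fourier 0 : C(UnitAddCircle, ℂ)) = 1 := by
  ext t; simp

theorem fourier_map_add (l m : ℤ) :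
    (fourier (l + m) : C(UnitAddCircle, ℂ)) = fourier l * fourier m := by
  ext t; exact fourier_add

/-- If `F` is a trigonometric polynomial of degree `s` with values in
`[((1 - q) / (1 + q)) ^ 2, 1]`, then its reciprocal `G` is uniformly approximated, at the rate
`q ^ (n + 1)`, by trigonometric polynomials of degree `n * s`; this bounds the Fourier coefficients
of `G`. -/
theorem norm_fourierCoeff_inv_le {q : ℝ} (h0 : 0 ≤ q) (h1 : q < 1) {s : ℕ}
    {F G : C(UnitAddCircle, ℂ)} (hF : F ∈ band ℂ (fourier (T := 1)) s)
    {f : UnitAddCircle → ℝ} (hf : ∀ t, F t = f t)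
    (hlo : ∀ t, (1 - q) ^ 2 ≤ (1 + q) ^ 2 * f t) (hhi : ∀ t, f t ≤ 1)
    (hG : ∀ t, G t = (F t)⁻¹) {n : ℕ} {l : ℤ} (hl : ((n * s : ℕ) : ℤ) < |l|) :
    ‖fourierCoeff G l‖ ≤ 2 * q ^ (n + 1) / (1 - q) ^ 2 := by
  have hq1 : 0 < 1 - q := sub_pos.2 h1
  have hq2 : 0 < 1 + q := by linarith
  -- The affine map sending the interval `[((1 - q) / (1 + q)) ^ 2, 1]` of values of `f` to `[-1,
  -- 1]`, chosen so that `(1 + q) ^ 2 f = 1 + q ^ 2 - 2 q x`.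
  let x : UnitAddCircle → ℝ := fun t => (1 + q ^ 2 - (1 + q) ^ 2 * f t) / (2 * q)
  have hx (t) : |x t| ≤ 1 := by
    rw [abs_div, abs_of_nonneg (by positivity : (0 : ℝ) ≤ 2 * q)]
    refine div_le_one_of_le₀ (abs_le.2 ⟨?_, ?_⟩) (by positivity)
    · nlinarith [hhi t, mul_pos hq2 hq2]
    · nlinarith [hlo t]
  have hxf (t) : 1 + q ^ 2 - 2 * q * x t = (1 + q) ^ 2 * f t := by
    -- For `q = 0` the quotient defining `x` is `0` by convention, and the bounds force `f = 1`.
    rcases h0.eq_or_lt with rfl | hq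
    · have := hlo t
      have := hhi t
      simp only [x]
      norm_num at *
      linarith
    · simp only [x]
      field_simp
      ring
  have hf0 (t) : 0 < f t := by
    have := (by positivity : 0 < (1 - q) ^ 2).trans_le (hlo t)
    exact pos_of_mul_pos_right this (by positivity)
  let X : C(UnitAddCircle, ℂ) :=
    algebraMap ℂ _ (((1 + q ^ 2) / (2 * q) : ℝ) : ℂ) - (((1 + q) ^ 2 / (2 * q) : ℝ) : ℂ) • F
  have hX (t) : X t = x t := by
    simp only [X, x, ContinuousMap.sub_apply, ContinuousMap.smul_apply, hf,
      Algebra.algebraMap_eq_smul_one, ContinuousMap.one_apply, smul_eq_mul, mul_one]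
    push_cast
    ring
  have hXb : X ∈ band ℂ (fourier (T := 1)) s :=
    Submodule.sub_mem _ (algebraMap_mem_band fourier_map_zero _ _) (Submodule.smul_mem _ _ hF)
  let p := (chebyshevApprox q n).map (algebraMap ℝ ℂ)
  let H : C(UnitAddCircle, ℂ) := (((1 + q) ^ 2 : ℝ) : ℂ) • Polynomial.aeval X p
  have hH : H ∈ band ℂ (fourier (T := 1)) (n * s) :=
    Submodule.smul_mem _ _ (aeval_mem_band fourier_map_zero fourier_map_add hXb
      (Polynomial.natDegree_map_le.trans (natDegree_chebyshevApprox_le q n)))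
  have hHt (t) : H t = (((1 + q) ^ 2 * (chebyshevApprox q n).eval (x t) : ℝ) : ℂ) := by
    have : (Polynomial.aeval X p) t = Polynomial.aeval (X t) p :=
      (Polynomial.aeval_algHom_apply (ContinuousMap.evalAlgHom ℂ ℂ t) X p).symm
    simp only [H, ContinuousMap.smul_apply, this, hX, p, smul_eq_mul]
    rw [Polynomial.aeval_map_algebraMap, ← Complex.coe_algebraMap,
      Polynomial.aeval_algebraMap_apply]
    simp
  -- `H` has no frequency beyond `n * s`, so subtracting it leaves the coefficient at `l` unchanged
  -- and only the uniform error matters.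
  have hsub : fourierCoeff G l = fourierCoeff (G - H : C(UnitAddCircle, ℂ)) l := by
    have := (fourierCoeffCLM l).map_sub G H
    simp only [fourierCoeffCLM_apply] at this
    rw [this, fourierCoeff_eq_zero_of_mem_band hH hl, sub_zero]
  rw [hsub]
  refine norm_fourierCoeff_le (fun t => ?_) l
  have key := abs_inv_sub_eval_chebyshevApprox_le h0 h1 (hx t) n
  rw [hxf] at key
  rw [ContinuousMap.sub_apply, hG, hHt, hf, ← Complex.ofReal_inv, ← Complex.ofReal_sub,
    Complex.norm_real, Real.norm_eq_abs]
  have e1 : (f t)⁻¹ - (1 + q) ^ 2 * (chebyshevApprox q n).eval (x t) =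
      (1 + q) ^ 2 * (((1 + q) ^ 2 * f t)⁻¹ - (chebyshevApprox q n).eval (x t)) := by
    have := (hf0 t).ne'
    field_simp
  have e2 : 2 * q ^ (n + 1) / (1 - q) ^ 2 = (1 + q) ^ 2 * (2 * q ^ (n + 1) / (1 - q ^ 2) ^ 2) := by
    rw [show 1 - q ^ 2 = (1 - q) * (1 + q) by ring]
    field_simp
  rw [e1, e2, abs_mul, abs_of_pos (by positivity)]
  gcongr

end Fourier

/-! ### Symbols and downsampling -/

section Symbol

open LaurentPolynomial in
theorem symbol_coeff (p : LaurentPolynomial ℝ) (z : ℂˣ) :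
    symbol p.coeff z = eval₂ Complex.ofRealHom z p := by
  have h1 : symbol p.coeff z = p.smeval z := by
    rw [symbol, smeval_eq_sum, Finsupp.sum, tsum_eq_sum (s := p.coeff.support)]
    · simp
    · intro l hl
      simp [Finsupp.notMem_support_iff.1 hl]
  rw [h1]
  clear h1
  induction p using LaurentPolynomial.induction_on' with
  | add p q hp hq => rw [smeval_add, map_add, hp, hq]
  | C_mul_T n a => simp

theorem symbol_evenPart {a : ℤ → ℝ} {S : Finset ℤ} (hS : ∀ i ∉ S, a i = 0) (z : ℂ) :
    symbol (evenPart a) (z ^ 2) = (symbol a z + symbol a (-z)) / 2 := by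
  have hs (w : ℂ) : Summable fun l : ℤ => (a l : ℂ) * w ^ l :=
    summable_of_ne_finset_zero (s := S) fun l hl => by simp [hS l hl]
  rw [symbol, symbol, symbol, ← (hs z).tsum_add (hs (-z)), ← tsum_div_const]
  refine Eq.trans (tsum_congr fun l => ?_)
    ((mul_right_injective₀ (two_ne_zero' ℤ)).tsum_eq fun l hl => ?_)
  · rw [evenPart, (even_two_mul l).neg_zpow, zpow_mul]
    norm_cast
    ring
  · rcases Int.even_or_odd' l with ⟨m, rfl | rfl⟩
    · exact ⟨m, rfl⟩
    · refine absurd ?_ hl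
      simp only [(odd_two_mul_add_one m).neg_zpow]
      ring

end Symbol

/-! ### Symbol and support of the pseudo-spline mask -/

section Mask

/-- With `y = (1 - Re z) / 2`, the factor `z⁻¹ (1 + z) ^ 2` equals `4 (1 - y)` on the circle, and
the base of the `j`-th powers is `y`. -/
theorem symbol_pseudoSplineMask (k ν : ℕ) {z : ℂ} (hz : ‖z‖ = 1) :
    symbol (pseudoSplineMask (2 * (k + 1)) ν) z =
      (2 * negBinomialCDF k ν ((1 - z.re) / 2) : ℝ) := by
  have hz0 : z ≠ 0 := norm_ne_zero_iff.1 (by rw [hz]; exact one_ne_zero)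
  have hinv : z⁻¹ = 2 * z.re - z := by
    rw [Complex.inv_eq_conj hz, eq_sub_iff_add_eq', Complex.add_conj]
    push_cast
    rfl
  have h := symbol_coeff (pseudoSplineSymbol (2 * (k + 1)) ν) (Units.mk0 z hz0)
  refine h.trans ?_
  have hmul : z⁻¹ ^ (k + 1) * (1 + z) ^ (2 * (k + 1)) = (2 + 2 * (z.re : ℂ)) ^ (k + 1) := by
    rw [pow_mul, ← mul_pow]
    congr 1
    have := inv_mul_cancel₀ hz0
    linear_combination (2 + z) * this + hinv
  have hpow : (2 : ℂ) ^ (2 * (k + 1) - 1) * 2 = 4 ^ (k + 1) := by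
    rw [← pow_succ, show 2 * (k + 1) - 1 + 1 = 2 * (k + 1) by omega, pow_mul]; norm_num
  have hsum : ∑ j ∈ Finset.range (ν + 1),
      ((Ring.choose (((2 * (k + 1) : ℕ) : ℝ) / 2 + j - 1) j : ℝ) : ℂ) *
      (1 / 2 - 1 / 4 * (z + z⁻¹)) ^ j =
      ∑ j ∈ Finset.range (ν + 1), ((k + j).choose j : ℂ) * ((1 - (z.re : ℂ)) / 2) ^ j := by
    refine Finset.sum_congr rfl fun j _ => ?_
    have e1 : ((2 * (k + 1) : ℕ) : ℝ) / 2 + j - 1 = ((k + j : ℕ) : ℝ) := by push_cast; ring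
    rw [e1, Ring.choose_natCast, hinv]
    push_cast
    congr 2
    ring
  have hev : LaurentPolynomial.eval₂ Complex.ofRealHom (Units.mk0 z hz0)
      (pseudoSplineSymbol (2 * (k + 1)) ν) = 1 / 2 ^ (2 * (k + 1) - 1) *
        (z⁻¹ ^ (k + 1) * (1 + z) ^ (2 * (k + 1))) *
        ∑ j ∈ Finset.range (ν + 1),
          ((Ring.choose (((2 * (k + 1) : ℕ) : ℝ) / 2 + j - 1) j : ℝ) : ℂ) *
            (1 / 2 - 1 / 4 * (z + z⁻¹)) ^ j := by
    simp only [pseudoSplineSymbol, map_mul, map_sum, map_pow, map_add, map_sub, map_one,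
      LaurentPolynomial.eval₂_C, LaurentPolynomial.eval₂_T, Complex.ofRealHom_eq_coe,
      Nat.mul_div_cancel_left _ zero_lt_two, Units.val_inv_eq_inv_val, Units.val_pow_eq_pow_val,
      Units.val_mk0, zpow_neg, zpow_natCast, zpow_one, inv_pow]
    push_cast
    ring
  rw [hev, hsum, hmul, negBinomialCDF]
  push_cast
  have h2 : (2 : ℂ) + 2 * z.re = 4 * (1 - (1 - z.re) / 2) := by ring
  rw [h2, mul_pow, ← hpow]
  field_simp

/-- Since `z⁻¹ (1 + z) ^ 2 = 2 + z + z⁻¹`, the first factor has degree at most `k + 1` in both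
directions; the sum adds at most `ν`. -/
theorem pseudoSplineMask_eq_zero (k ν : ℕ) {l : ℤ} (hl : ((k + 1 + ν : ℕ) : ℤ) < |l|) :
    pseudoSplineMask (2 * (k + 1)) ν l = 0 := by
  let e : ℤ → LaurentPolynomial ℝ := LaurentPolynomial.T
  have h0 : e 0 = 1 := LaurentPolynomial.T_zero
  have he (l m : ℤ) : e (l + m) = e l * e m := LaurentPolynomial.T_add l m
  have hC (r : ℝ) (d : ℕ) : LaurentPolynomial.C r ∈ band ℝ e d := by
    rw [LaurentPolynomial.C_eq_algebraMap]
    exact algebraMap_mem_band h0 r d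
  have h1 : e 1 ∈ band ℝ e 1 := mem_band (by simp)
  have h2 : e (-1) ∈ band ℝ e 1 := mem_band (by simp)
  have hT : e (-((k + 1 : ℕ) : ℤ)) * (1 + e 1) ^ (2 * (k + 1)) =
      (2 + (e 1 + e (-1))) ^ (k + 1) := by
    have h3 : e (-((k + 1 : ℕ) : ℤ)) = e (-1) ^ (k + 1) := by
      simp only [e, LaurentPolynomial.T_pow]
      congr 1
      ring
    have h4 : e (-1) * e 1 = 1 := by rw [← he, ← h0]; rfl
    rw [h3, pow_mul, ← mul_pow]
    congr 1
    linear_combination (2 + e 1) * h4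
  have hmem : pseudoSplineSymbol (2 * (k + 1)) ν ∈ band ℝ e (k + 1 + ν) := by
    have h5 : pseudoSplineSymbol (2 * (k + 1)) ν = LaurentPolynomial.C (1 / 2 ^ (2 * (k + 1) - 1)) *
        (2 + (e 1 + e (-1))) ^ (k + 1) * ∑ j ∈ Finset.range (ν + 1),
          LaurentPolynomial.C (Ring.choose (((2 * (k + 1) : ℕ) : ℝ) / 2 + j - 1) j) *
            (LaurentPolynomial.C (1 / 2) - LaurentPolynomial.C (1 / 4) * (e 1 + e (-1))) ^ j := by
      rw [← hT, pseudoSplineSymbol, Nat.mul_div_cancel_left _ zero_lt_two]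
      simp only [e, mul_assoc]
    rw [h5]
    refine mul_mem_band he ?_ (Submodule.sum_mem _ fun j hj => ?_)
    · have := pow_mem_band h0 he (Submodule.add_mem _ (hC 2 1) (Submodule.add_mem _ h1 h2)) (k + 1)
      rw [mul_one, show LaurentPolynomial.C (2 : ℝ) = 2 from map_ofNat _ 2] at this
      simpa using mul_mem_band he (hC _ 0) this
    · have h6 := pow_mem_band h0 he (Submodule.sub_mem _ (hC (1 / 2) 1)
        (by simpa using mul_mem_band he (hC (1 / 4) 0) (Submodule.add_mem _ h1 h2))) j
      have h7 : j * 1 ≤ ν := by simpa using Nat.lt_succ_iff.1 (Finset.mem_range.1 hj)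
      simpa using mul_mem_band he (hC _ 0) (band_mono h7 h6)
  have hle : band ℝ e (k + 1 + ν) ≤
      LinearMap.ker ((Finsupp.lapply l).comp
        (AddMonoidAlgebra.coeffLinearEquiv ℝ).toLinearMap : LaurentPolynomial ℝ →ₗ[ℝ] ℝ) := by
    refine Submodule.span_le.2 ?_
    rintro _ ⟨m, hm, rfl⟩
    have hne : m ≠ l := by rintro rfl; exact absurd hm (not_le.2 hl)
    simp [e, hne]
  exact hle hmem

theorem symbol_evenPart_pseudoSplineMask (k ν : ℕ) {z : ℂ} (hz : ‖z‖ = 1) :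
    symbol (evenPart (pseudoSplineMask (2 * (k + 1)) ν)) (z ^ 2) =
      (negBinomialCDF k ν ((1 - z.re) / 2) + negBinomialCDF k ν (1 - (1 - z.re) / 2) : ℝ) := by
  have hS : ∀ i ∉ (pseudoSplineSymbol (2 * (k + 1)) ν).coeff.support,
      pseudoSplineMask (2 * (k + 1)) ν i = 0 := fun _ => Finsupp.notMem_support_iff.1
  rw [symbol_evenPart hS, symbol_pseudoSplineMask k ν hz,
    symbol_pseudoSplineMask k ν (by rwa [norm_neg]), Complex.neg_re,
    show (1 - -z.re) / 2 = 1 - (1 - z.re) / 2 by ring]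
  push_cast
  ring

theorem exists_symbol_evenPart_pseudoSplineMask_eq {k ν : ℕ} (h : ν ≤ k) {z : ℂ} (hz : ‖z‖ = 1) :
    ∃ r ∈ Set.Icc (kappa (k + 1) ν)⁻¹ 1,
      symbol (evenPart (pseudoSplineMask (2 * (k + 1)) ν)) z = (r : ℂ) := by
  -- The even symbol is known at squares only, so pass to a square root.
  obtain ⟨w, rfl⟩ := IsAlgClosed.exists_pow_nat_eq z zero_lt_two
  have hw : ‖w‖ = 1 := by
    rwa [norm_pow, pow_eq_one_iff_of_nonneg (norm_nonneg _) two_ne_zero] at hz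
  have hre := abs_le.1 ((Complex.abs_re_le_norm w).trans hw.le)
  refine ⟨_, ?_, symbol_evenPart_pseudoSplineMask k ν hw⟩
  rw [← two_mul_negBinomialCDF_half]
  exact negBinomialCDF_add_mem_Icc h (by linarith) (by linarith)

theorem evenPart_pseudoSplineMask_eq_zero (k ν : ℕ) {l : ℤ}
    (hl : (((k + 1 + ν) / 2 : ℕ) : ℤ) < |l|) :
    evenPart (pseudoSplineMask (2 * (k + 1)) ν) l = 0 := by
  refine pseudoSplineMask_eq_zero k ν ?_
  rw [abs_mul, abs_two]
  omega

/-- A finite interval that contains the support of the even part of the mask. -/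
def evenMaskSupport (k ν : ℕ) : Finset ℤ :=
  Finset.Icc (-((k + 1 + ν) / 2 : ℕ) : ℤ) ((k + 1 + ν) / 2 : ℕ)

theorem evenPart_pseudoSplineMask_eq_zero_of_notMem (k ν : ℕ) {l : ℤ}
    (hl : l ∉ evenMaskSupport k ν) : evenPart (pseudoSplineMask (2 * (k + 1)) ν) l = 0 := by
  rw [evenMaskSupport, Finset.mem_Icc, ← abs_le, not_le] at hl
  exact evenPart_pseudoSplineMask_eq_zero k ν hl

theorem symbol_evenPart_pseudoSplineMask_ne_zero {k ν : ℕ} (h : ν ≤ k) {z : ℂ} (hz : ‖z‖ = 1) :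
    symbol (evenPart (pseudoSplineMask (2 * (k + 1)) ν)) z ≠ 0 := by
  obtain ⟨r, hr, e⟩ := exists_symbol_evenPart_pseudoSplineMask_eq h hz
  rw [e]
  exact_mod_cast ((inv_pos.2 (kappa_pos (k + 1) ν)).trans_le hr.1).ne'

end Mask

/-! ### Absolutely summable sequences and their symbols -/

section FourierSeries

theorem norm_fourier_one (t : UnitAddCircle) : ‖(fourier 1 t : ℂ)‖ = 1 := by
  rw [fourier_apply]; exact Circle.norm_coe _

theorem fourier_eq_zpow (l : ℤ) (t : UnitAddCircle) : (fourier l t : ℂ) = fourier 1 t ^ l := by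
  rw [fourier_apply, fourier_one, AddCircle.toCircle_zsmul, Circle.coe_zpow]

theorem exists_fourier_one_eq {z : ℂ} (hz : ‖z‖ = 1) : ∃ t : UnitAddCircle, fourier 1 t = z := by
  obtain ⟨t, ht⟩ := (AddCircle.homeomorphCircle (T := 1) one_ne_zero).surjective
    ⟨z, mem_sphere_zero_iff_norm.2 hz⟩
  refine ⟨t, ?_⟩
  rw [fourier_one, ← AddCircle.homeomorphCircle_apply one_ne_zero, ht]

/-- The function `t ↦ c(e ^ {2 π i t})` on the circle. -/
def symbolMap (c : ℤ → ℝ) : C(UnitAddCircle, ℂ) := ∑' l : ℤ, (c l : ℂ) • fourier l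

variable {c d : ℤ → ℝ}

theorem hasSum_symbolMap (hc : Summable fun l => ‖c l‖) :
    HasSum (fun l : ℤ => (c l : ℂ) • (fourier l : C(UnitAddCircle, ℂ))) (symbolMap c) := by
  refine (Summable.of_norm_bounded hc fun l => ?_).hasSum
  rw [norm_smul, fourier_norm, mul_one, Complex.norm_real]

theorem symbolMap_apply (hc : Summable fun l => ‖c l‖) (t : UnitAddCircle) :
    symbolMap c t = symbol c (fourier 1 t) := by
  have h := (hasSum_symbolMap hc).mapL (ContinuousMap.evalCLM ℂ t)
  refine h.tsum_eq.symm.trans (tsum_congr fun l => ?_)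
  simp [fourier_eq_zpow l t, -fourier_apply]

theorem fourierCoeff_symbolMap (hc : Summable fun l => ‖c l‖) (n : ℤ) :
    fourierCoeff (symbolMap c) n = c n := by
  have h := (hasSum_symbolMap hc).mapL (fourierCoeffCLM n)
  refine h.unique ?_
  convert hasSum_ite_eq n (c n : ℂ) using 2 with l
  rw [map_smul, fourierCoeffCLM_apply, fourierCoeff_fourier]
  rcases eq_or_ne l n with rfl | h <;> simp [*, Ne.symm]

theorem symbol_injective (hc : Summable fun l => ‖c l‖) (hd : Summable fun l => ‖d l‖)
    (h : ∀ z : ℂ, ‖z‖ = 1 → symbol c z = symbol d z) : c = d := by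
  have : symbolMap c = symbolMap d := by
    ext t
    rw [symbolMap_apply hc, symbolMap_apply hd, h _ (norm_fourier_one t)]
  funext n
  have h2 := fourierCoeff_symbolMap hc n
  rw [this, fourierCoeff_symbolMap hd n] at h2
  exact_mod_cast h2.symm

theorem symbol_conj (c : ℤ → ℝ) (z : ℂ) :
    symbol c (starRingEnd ℂ z) = starRingEnd ℂ (symbol c z) := by
  rw [symbol, symbol, Complex.conj_tsum]
  simp

theorem fourier_neg_arg (l : ℤ) (t : UnitAddCircle) :
    (fourier l (-t) : ℂ) = starRingEnd ℂ (fourier l t) := by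
  rw [← fourier_neg, fourier_apply, fourier_apply, smul_neg, neg_smul]

/-- A function with absolutely summable Fourier coefficients and the symmetry of a function with
real coefficients is the symbol of a real sequence. -/
theorem exists_symbol_eq {G : C(UnitAddCircle, ℂ)} (hG : Summable fun l => ‖fourierCoeff G l‖)
    (hconj : ∀ t, G (-t) = starRingEnd ℂ (G t)) :
    ∃ γ : ℤ → ℝ, (Summable fun l => ‖γ l‖) ∧ ∀ t, symbol γ (fourier 1 t) = G t := by
  refine ⟨fun l => (fourierCoeff G l).re,
    hG.of_nonneg_of_le (fun _ => norm_nonneg _) fun l => Complex.abs_re_le_norm _, fun t => ?_⟩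
  have h (t) : HasSum (fun l => fourierCoeff G l • (fourier l t : ℂ)) (G t) :=
    has_pointwise_sum_fourier_series_of_summable hG.of_norm t
  -- Conjugating the series at `-t` gives a second expansion of `G t`, with conjugate coefficients;
  -- averaging the two leaves the real parts.
  have h2 := (Complex.hasSum_conj'.2 (h (-t)))
  rw [hconj, Complex.conj_conj] at h2
  have h3 := ((h t).add h2).div_const 2
  rw [add_self_div_two] at h3
  rw [← h3.tsum_eq]
  refine tsum_congr fun l => ?_
  rw [smul_eq_mul, smul_eq_mul, map_mul, fourier_neg_arg, Complex.conj_conj, ← add_mul,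
    Complex.add_conj, ← fourier_eq_zpow]
  push_cast
  ring

end FourierSeries

/-! ### Decimation norm and the even-inverse property -/

section Decimation

theorem norm_decimation (γ : SeqL1) : ‖decimation γ‖ = ‖γ‖ := by
  refine le_antisymm (LinearMap.mkContinuous_norm_le _ (norm_nonneg _) _) ?_
  -- Only the entries at `-2 l` matter, where the value is the sign of `γ l`; the output at `0` is
  -- then `‖γ‖`.
  let σ : ℤ → ℝ := fun m => SignType.sign (γ (-(m / 2)))
  have hσ (m) : ‖σ m‖ ≤ 1 := by
    simp only [σ]
    rcases SignType.trichotomy (SignType.sign (γ (-(m / 2)))) with h | h | h <;> simp [h]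
  let c : SeqLInf := ⟨σ, memℓp_infty ⟨1, by rintro _ ⟨m, rfl⟩; exact hσ m⟩⟩
  have hc : ‖c‖ ≤ 1 := lp.norm_le_of_forall_le zero_le_one hσ
  have h0 : decimation γ c 0 = ‖γ‖ := by
    rw [norm_eq_tsum]
    refine tsum_congr fun l => ?_
    change γ l * SignType.sign (γ (-((2 * (0 - l)) / 2))) = _
    rw [Int.mul_ediv_cancel_left _ two_ne_zero, zero_sub, neg_neg, mul_comm, sign_mul_self,
      Real.norm_eq_abs]
  calc ‖γ‖ = ‖decimation γ c 0‖ := by rw [h0, norm_norm]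
    _ ≤ ‖decimation γ c‖ := lp.norm_apply_le_norm (by simp) _ _
    _ ≤ ‖decimation γ‖ * ‖c‖ := (decimation γ).le_opNorm c
    _ ≤ ‖decimation γ‖ := mul_le_of_le_one_right (norm_nonneg _) hc

theorem summable_norm_shift (γ : SeqL1) (i : ℤ) : Summable fun n : ℤ => ‖γ (n - i)‖ :=
  (Equiv.subRight i).summable_iff.2 (summable_norm γ)

theorem symbol_sum_mul_shift {g : ℤ → ℝ} (hg : Summable fun l => ‖g l‖) (S : Finset ℤ)
    (a : ℤ → ℝ) {z : ℂ} (hz : ‖z‖ = 1) :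
    symbol (fun n : ℤ => ∑ i ∈ S, a i * g (n - i)) z =
      (∑ i ∈ S, (a i : ℂ) * z ^ i) * symbol g z := by
  have hz0 : z ≠ 0 := norm_ne_zero_iff.1 (by rw [hz]; exact one_ne_zero)
  have hsum : Summable fun n : ℤ => (g n : ℂ) * z ^ n := by
    refine Summable.of_norm_bounded hg fun n => ?_
    rw [norm_mul, norm_zpow, hz, one_zpow, mul_one, Complex.norm_real]
  have hshift (i : ℤ) : HasSum (fun n : ℤ => (a i : ℂ) * z ^ i * ((g (n - i) : ℂ) * z ^ (n - i)))
      ((a i : ℂ) * z ^ i * symbol g z) :=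
    (((Equiv.subRight i).hasSum_iff (f := fun n : ℤ => (g n : ℂ) * z ^ n)).2
      hsum.hasSum).mul_left _
  rw [Finset.sum_mul, ← (hasSum_sum fun i _ => hshift i).tsum_eq]
  refine tsum_congr fun n => ?_
  push_cast
  rw [Finset.sum_mul]
  refine Finset.sum_congr rfl fun i _ => ?_
  rw [zpow_sub₀ hz0]
  have := zpow_ne_zero i hz0
  field_simp

/-- A mask inverse is an inverse for the convolution of sequences. -/
theorem IsMaskInverse.sum_mul_eq {a : ℤ → ℝ} {γ : SeqL1} (h : IsMaskInverse a γ) {S : Finset ℤ}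
    (hS : ∀ i ∉ S, a i = 0) :
    (fun n : ℤ => ∑ i ∈ S, a i * γ (n - i)) = Pi.single 0 1 := by
  refine symbol_injective ?_ ?_ fun z hz => ?_
  · refine Summable.of_nonneg_of_le (fun _ => norm_nonneg _) (fun n => norm_sum_le _ _)
      (summable_sum fun i _ => ?_)
    simpa only [norm_mul] using (summable_norm_shift γ i).mul_left ‖a i‖
  · refine summable_of_ne_finset_zero (s := {0}) fun l hl => ?_
    rw [Pi.single_eq_of_ne (Finset.notMem_singleton.1 hl), norm_zero]
  · have hz0 : z ≠ 0 := norm_ne_zero_iff.1 (by rw [hz]; exact one_ne_zero)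
    have hδ : symbol (Pi.single 0 1) z = 1 := by
      rw [symbol, tsum_eq_single 0 fun l hl => by simp [Pi.single_eq_of_ne hl]]
      simp
    have ha : symbol a z = ∑ i ∈ S, (a i : ℂ) * z ^ i :=
      tsum_eq_sum fun i hi => by simp [hS i hi]
    have h1 := symbol_sum_mul_shift (summable_norm γ) S a hz
    rw [← ha] at h1
    rw [h1, hδ, (h z hz).2, mul_one_div_cancel (h z hz).1]

/-- At even positions subdivision convolves with the even part of `α` alone, so the composite
convolves the downsampled `c` with `evenPart α * γ`, the unit impulse. -/
theorem IsMaskInverse.isEvenInverse {α : ℤ → ℝ} {γ : SeqL1} (h : IsMaskInverse (evenPart α) γ)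
    {S : Finset ℤ} (hS : ∀ i ∉ S, evenPart α i = 0) : IsEvenInverse α γ := by
  intro c m
  rw [sub_eq_zero]
  have h1 (i : ℤ) : decimation γ c (m - i) = ∑' n : ℤ, γ (n - i) * c (2 * (m - n)) := by
    change ∑' j : ℤ, γ j * c (2 * (m - i - j)) = _
    rw [← (Equiv.subRight i).tsum_eq]
    refine tsum_congr fun n => ?_
    rw [Equiv.subRight_apply, show m - i - (n - i) = m - n by ring]
  have hs (i : ℤ) : Summable fun n : ℤ => γ (n - i) * c (2 * (m - n)) :=
    Summable.of_norm_bounded ((summable_norm_shift γ i).mul_right ‖c‖) fun n =>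
      norm_term_le γ c (n - i) _
  have h2 : subdivision α (decimation γ c) (2 * m) =
      ∑ i ∈ S, evenPart α i * decimation γ c (m - i) := by
    rw [subdivision, ← (Equiv.subLeft m).tsum_eq, tsum_eq_sum (s := S)]
    · refine Finset.sum_congr rfl fun i _ => ?_
      rw [Equiv.subLeft_apply, evenPart, show 2 * m - 2 * (m - i) = 2 * i by ring]
    · intro i hi
      have := hS i hi
      rw [evenPart] at this
      rw [Equiv.subLeft_apply, show 2 * m - 2 * (m - i) = 2 * i by ring, this, zero_mul]
  rw [h2]
  simp only [h1, ← tsum_mul_left]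
  rw [← Summable.tsum_finsetSum fun i _ => (hs i).mul_left _]
  have h3 (n : ℤ) : ∑ i ∈ S, evenPart α i * (γ (n - i) * c (2 * (m - n))) =
      (Pi.single 0 1 : ℤ → ℝ) n * c (2 * (m - n)) := by
    rw [← h.sum_mul_eq hS, Finset.sum_mul]
    simp only [mul_assoc]
  simp only [h3]
  rw [tsum_eq_single 0 fun n hn => by simp [Pi.single_eq_of_ne hn]]
  simp

end Decimation

/-! ### Geometric decay and the explicit constant -/

section Decay

theorem hasSum_pow_natAbs {r : ℝ} (h0 : 0 ≤ r) (h1 : r < 1) :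
    HasSum (fun l : ℤ => r ^ l.natAbs) ((1 + r) / (1 - r)) := by
  have h := hasSum_geometric_of_lt_one h0 h1
  have h2 : HasSum (fun l : ℤ => r ^ l.natAbs) ((1 - r)⁻¹ + r * (1 - r)⁻¹) := by
    refine HasSum.of_nat_of_neg_add_one (by simpa using h) ?_
    have e (n : ℕ) : r ^ (-((n : ℤ) + 1)).natAbs = r * r ^ n := by
      rw [← pow_succ']
      congr 1
    simpa only [e] using h.mul_left r
  convert h2 using 1
  have : 1 - r ≠ 0 := (sub_pos.2 h1).ne'
  field_simp

/-- The quantity `q = (√κ - 1) / (√κ + 1)`. -/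
def condRatio (k ν : ℕ) : ℝ := (√(kappa k ν) - 1) / (√(kappa k ν) + 1)

variable {k ν : ℕ}

theorem one_le_sqrt_kappa (h : ν ≤ k) : 1 ≤ √(kappa (k + 1) ν) :=
  Real.one_le_sqrt.2 (one_le_kappa h)

theorem condRatio_nonneg (h : ν ≤ k) : 0 ≤ condRatio (k + 1) ν := by
  have := one_le_sqrt_kappa h
  exact div_nonneg (by linarith) (by linarith)

theorem one_sub_condRatio (k ν : ℕ) : 1 - condRatio k ν = 2 / (√(kappa k ν) + 1) := by
  have : √(kappa k ν) + 1 ≠ 0 := by positivity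
  rw [condRatio]
  field_simp
  ring

/-- This says `((1 - q) / (1 + q)) ^ 2 = 1/κ`, matching the interval of the approximation estimate
with the range of the even symbol. -/
theorem one_add_condRatio (k ν : ℕ) :
    1 + condRatio k ν = √(kappa k ν) * (1 - condRatio k ν) := by
  have : √(kappa k ν) + 1 ≠ 0 := by positivity
  rw [one_sub_condRatio, condRatio]
  field_simp
  ring

theorem condRatio_lt_one (k ν : ℕ) : condRatio k ν < 1 := by
  rw [← sub_pos, one_sub_condRatio]
  positivity

theorem decayRate_nonneg (h : ν ≤ k) : 0 ≤ decayRate (k + 1) ν :=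
  Real.rpow_nonneg (condRatio_nonneg h) _

/-- The condition `1 ≤ k` makes `s` positive, without which the `s`-th root could not be undone. -/
theorem decayRate_pow (h : ν ≤ k) (hk : 1 ≤ k) :
    decayRate (k + 1) ν ^ ((k + 1 + ν) / 2) = condRatio (k + 1) ν := by
  rw [decayRate, one_div]
  exact Real.rpow_inv_natCast_pow (condRatio_nonneg h) (by omega)

theorem decayRate_lt_one (h : ν ≤ k) (hk : 1 ≤ k) : decayRate (k + 1) ν < 1 := by
  refine Real.rpow_lt_one (condRatio_nonneg h) (condRatio_lt_one _ _) ?_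
  have : 0 < (k + 1 + ν) / 2 := by omega
  positivity

theorem summable_norm_evenMask (k ν : ℕ) :
    Summable fun l => ‖evenPart (pseudoSplineMask (2 * (k + 1)) ν) l‖ := by
  refine summable_of_ne_finset_zero (s := evenMaskSupport k ν) fun l hl => ?_
  rw [evenPart_pseudoSplineMask_eq_zero_of_notMem k ν hl, norm_zero]

theorem symbolMap_evenMask_mem_band (k ν : ℕ) :
    symbolMap (evenPart (pseudoSplineMask (2 * (k + 1)) ν)) ∈
      band ℂ (fourier (T := 1)) ((k + 1 + ν) / 2) := by
  rw [symbolMap, tsum_eq_sum (s := evenMaskSupport k ν)]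
  · refine Submodule.sum_mem _ fun l hl => Submodule.smul_mem _ _ (mem_band ?_)
    exact abs_le.2 (Finset.mem_Icc.1 hl)
  · intro l hl
    rw [evenPart_pseudoSplineMask_eq_zero_of_notMem k ν hl, Complex.ofReal_zero]
    exact zero_smul ℂ (fourier l : C(UnitAddCircle, ℂ))

/-- The factor in front of the geometric decay in `boundConst`. -/
def decayConst (k ν : ℕ) : ℝ :=
  kappa k ν * max 1 ((1 + √(kappa k ν)) ^ 2 / (2 * kappa k ν))

theorem decayConst_eq (k ν : ℕ) :
    decayConst k ν = max (kappa k ν) ((1 + √(kappa k ν)) ^ 2 / 2) := by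
  have := kappa_pos k ν
  rw [decayConst, mul_max_of_nonneg _ _ this.le, mul_one]
  congr 1
  field_simp

theorem norm_fourierCoeff_inv_symbol_le (h : ν ≤ k) (hk : 1 ≤ k) {G : C(UnitAddCircle, ℂ)}
    (hG : ∀ t, G t = (symbolMap (evenPart (pseudoSplineMask (2 * (k + 1)) ν)) t)⁻¹) (l : ℤ) :
    ‖fourierCoeff G l‖ ≤ decayConst (k + 1) ν * decayRate (k + 1) ν ^ l.natAbs := by
  have hκ := kappa_pos (k + 1) ν
  have hf (t : UnitAddCircle) : ∃ r ∈ Set.Icc (kappa (k + 1) ν)⁻¹ 1,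
      symbolMap (evenPart (pseudoSplineMask (2 * (k + 1)) ν)) t = (r : ℂ) := by
    rw [symbolMap_apply (summable_norm_evenMask k ν)]
    exact exists_symbol_evenPart_pseudoSplineMask_eq h (norm_fourier_one t)
  choose f hf hF using hf
  -- No `n` satisfies `n * s < 0`, so `l = 0` uses the uniform bound `G ≤ κ`; this is the first
  -- entry of the maximum in the constant.
  rcases eq_or_ne l 0 with rfl | hl
  · rw [Int.natAbs_zero, pow_zero, mul_one, decayConst_eq]
    refine le_max_of_le_left (norm_fourierCoeff_le (fun t => ?_) 0)
    rw [hG, hF, norm_inv, Complex.norm_real,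
      Real.norm_of_nonneg ((inv_pos.2 hκ).le.trans (hf t).1)]
    exact inv_le_of_inv_le₀ hκ (hf t).1
  set s := (k + 1 + ν) / 2 with hs
  have hs0 : 0 < s := by omega
  have hl0 : 0 < l.natAbs := Int.natAbs_pos.2 hl
  -- The largest `n` with `n * s < |l|`; the approximant misses frequency `l`, while `|l| ≤ s (n +
  -- 1)` gives `q ^ (n + 1) ≤ λ ^ |l|`.
  set n := (l.natAbs - 1) / s
  have hn : n * s < l.natAbs := by
    have : n * s ≤ l.natAbs - 1 := Nat.div_mul_le_self _ s
    omega
  have hn' : l.natAbs ≤ s * (n + 1) := by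
    have : l.natAbs - 1 < s * (n + 1) := Nat.lt_mul_div_succ _ hs0
    omega
  have hq : 0 < 1 - condRatio (k + 1) ν := sub_pos.2 (condRatio_lt_one _ _)
  have key := norm_fourierCoeff_inv_le (condRatio_nonneg h) (condRatio_lt_one _ _)
    (symbolMap_evenMask_mem_band k ν) hF (fun t => ?_) (fun t => (hf t).2) hG (n := n) (l := l)
    (by rw [Int.abs_eq_natAbs]; exact_mod_cast hn)
  · refine key.trans ?_
    -- As `1 - q = 2 / (√κ + 1)`, the prefactor is `(1 + √κ) ^ 2 / 2`, the second entry of the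
    -- maximum.
    have e : 2 * condRatio (k + 1) ν ^ (n + 1) / (1 - condRatio (k + 1) ν) ^ 2 =
        (1 + √(kappa (k + 1) ν)) ^ 2 / 2 * condRatio (k + 1) ν ^ (n + 1) := by
      rw [one_sub_condRatio]
      field_simp
      ring
    rw [e, ← decayRate_pow h hk, ← pow_mul]
    refine mul_le_mul ?_ (pow_le_pow_of_le_one (decayRate_nonneg h) (decayRate_lt_one h hk).le hn')
      (pow_nonneg (decayRate_nonneg h) _) ?_
    · rw [decayConst_eq]; exact le_max_right _ _
    · rw [decayConst_eq]; exact hκ.le.trans (le_max_left _ _)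
  · rw [one_add_condRatio, mul_pow, Real.sq_sqrt hκ.le, mul_right_comm]
    refine le_mul_of_one_le_left (by positivity) ?_
    rw [← mul_inv_cancel₀ hκ.ne']
    exact mul_le_mul_of_nonneg_left (hf t).1 hκ.le

theorem exists_inv_symbolMap (h : ν ≤ k) : ∃ G : C(UnitAddCircle, ℂ),
    ∀ t, G t = (symbolMap (evenPart (pseudoSplineMask (2 * (k + 1)) ν)) t)⁻¹ := by
  refine ⟨⟨fun t => (symbolMap (evenPart (pseudoSplineMask (2 * (k + 1)) ν)) t)⁻¹,
    (ContinuousMap.continuous _).inv₀ fun t => ?_⟩, fun t => rfl⟩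
  rw [symbolMap_apply (summable_norm_evenMask k ν)]
  exact symbol_evenPart_pseudoSplineMask_ne_zero h (norm_fourier_one t)

theorem summable_norm_fourierCoeff_inv_symbol (h : ν ≤ k) (hk : 1 ≤ k) {G : C(UnitAddCircle, ℂ)}
    (hG : ∀ t, G t = (symbolMap (evenPart (pseudoSplineMask (2 * (k + 1)) ν)) t)⁻¹) :
    Summable fun l => ‖fourierCoeff G l‖ :=
  Summable.of_nonneg_of_le (fun _ => norm_nonneg _) (norm_fourierCoeff_inv_symbol_le h hk hG)
    ((hasSum_pow_natAbs (decayRate_nonneg h) (decayRate_lt_one h hk)).summable.mul_left _)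

theorem exists_isMaskInverse (h : ν ≤ k) (hk : 1 ≤ k) :
    ∃ γ : SeqL1, IsMaskInverse (evenPart (pseudoSplineMask (2 * (k + 1)) ν)) γ := by
  obtain ⟨G, hG⟩ := exists_inv_symbolMap h
  have hF := symbolMap_apply (summable_norm_evenMask k ν)
  obtain ⟨γ, hγ, hγG⟩ := exists_symbol_eq (summable_norm_fourierCoeff_inv_symbol h hk hG)
    -- Real mask coefficients make the reciprocal conjugate-symmetric, so `γ` can be taken real.
    fun t => by rw [hG, hG, hF, hF, fourier_neg_arg, symbol_conj, map_inv₀]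
  refine ⟨⟨γ, memℓp_gen (by simpa using hγ)⟩, fun z hz =>
    ⟨symbol_evenPart_pseudoSplineMask_ne_zero h hz, ?_⟩⟩
  obtain ⟨t, rfl⟩ := exists_fourier_one_eq hz
  rw [one_div, ← hF, ← hG]
  exact hγG t

theorem IsMaskInverse.unique {a : ℤ → ℝ} {γ δ : SeqL1} (hγ : IsMaskInverse a γ)
    (hδ : IsMaskInverse a δ) : γ = δ := by
  refine lp.ext (symbol_injective (summable_norm γ) (summable_norm δ) fun z hz => ?_)
  rw [(hγ z hz).2, (hδ z hz).2]

theorem norm_le_boundConst (h : ν ≤ k) (hk : 1 ≤ k) {γ : SeqL1}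
    (hγ : IsMaskInverse (evenPart (pseudoSplineMask (2 * (k + 1)) ν)) γ) :
    ‖γ‖ ≤ boundConst (k + 1) ν := by
  have hG (t : UnitAddCircle) : symbolMap γ t =
      (symbolMap (evenPart (pseudoSplineMask (2 * (k + 1)) ν)) t)⁻¹ := by
    rw [symbolMap_apply (summable_norm γ), symbolMap_apply (summable_norm_evenMask k ν),
      (hγ _ (norm_fourier_one t)).2, one_div]
  have hle (l : ℤ) : ‖γ l‖ ≤ decayConst (k + 1) ν * decayRate (k + 1) ν ^ l.natAbs := by
    rw [← Complex.norm_real, ← fourierCoeff_symbolMap (summable_norm γ)]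
    exact norm_fourierCoeff_inv_symbol_le h hk hG l
  rw [norm_eq_tsum]
  exact hasSum_le hle (summable_norm γ).hasSum
    ((hasSum_pow_natAbs (decayRate_nonneg h) (decayRate_lt_one h hk)).mul_left _)

end Decay

end PseudoSpline

end

theorem mainTheorem9 (k ν : ℕ) (hk : 2 ≤ k) (hν : ν ≤ k - 1) :
    (∃! γ : PseudoSpline.SeqL1,
      PseudoSpline.IsMaskInverse
        (PseudoSpline.evenPart (PseudoSpline.pseudoSplineMask (2 * k) ν)) γ) ∧
    ∀ γ : PseudoSpline.SeqL1,
      PseudoSpline.IsMaskInverse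
        (PseudoSpline.evenPart (PseudoSpline.pseudoSplineMask (2 * k) ν)) γ →
      PseudoSpline.IsEvenInverse (PseudoSpline.pseudoSplineMask (2 * k) ν) γ ∧
      ‖PseudoSpline.decimation γ‖ = ‖γ‖ ∧
      ‖γ‖ ≤ PseudoSpline.boundConst k ν := by
  obtain ⟨k, rfl⟩ : ∃ m, k = m + 1 := ⟨k - 1, by omega⟩
  rw [Nat.add_sub_cancel] at hν
  have hk1 : 1 ≤ k := by omega
  obtain ⟨γ₀, h₀⟩ := PseudoSpline.exists_isMaskInverse hν hk1
  refine ⟨⟨γ₀, h₀, fun γ hγ => hγ.unique h₀⟩, fun γ hγ =>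
    ⟨hγ.isEvenInverse (S := PseudoSpline.evenMaskSupport k ν)
      fun l => PseudoSpline.evenPart_pseudoSplineMask_eq_zero_of_notMem k ν,
      PseudoSpline.norm_decimation γ, PseudoSpline.norm_le_boundConst hν hk1 hγ⟩⟩
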